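/- A directed acyclic graph (DAG) encodes the conditional independence relations "$X_A \perp X_B \mid X_C$" given by its d-separation statements, where $A,B,C$ range over pairwise disjoint sets of nodes; two DAGs on the same node set are Markov equivalent if they encode the same relations. The skeleton of a DAG is its underlying undirected graph. For a finite undirected graph $G$, let $M(G)$ be the number of Markov equivalence classes (MECs) of DAGs with skeleton $G$. For $k\ge 1$, let $T_k$ be the complete binary tree with $2^k-1$ nodes ($k$ levels, every non-leaf node having exactly two children), and let $A_k$ be the additive tree obtained from $T_k$ by attaching one new leaf to the root. **Theorem.** For every integer $k\ge 2$, $$ 1 < \frac{M(A_k)}{M(T_k)} < 4 . $$ -/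

import Mathlib

/-- A directed acyclic graph on the vertex set `V`: a directed graph without directed cycles
(in particular without loops and without pairs of opposite arrows). -/
structure DAG (V : Type*) extends Digraph V where
  acyclic : ∀ v, ¬ Relation.TransGen Adj v v

namespace DAG

variable {V : Type*}

/-- The skeleton: the underlying undirected graph. -/
def skeleton (G : DAG V) : SimpleGraph V where
  Adj u v := G.Adj u v ∨ G.Adj v u
  symm := ⟨fun _ _ h => h.symm⟩
  loopless := ⟨fun v h => G.acyclic v (Relation.TransGen.single (h.elim id id))⟩

/-- A vertex is counted as a descendant of itself, as usual in the definition of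
d-separation. -/
def Descendant (G : DAG V) (u v : V) : Prop := Relation.ReflTransGen G.Adj u v

/-- The path `p` is active (d-connecting) given `C`: every collider `a → b ← c` on `p` has a
descendant in `C`, and no interior vertex of `p` that is not a collider on `p` lies in `C`. -/
def IsActive (G : DAG V) (C : Set V) {u v : V} (p : G.skeleton.Walk u v) : Prop :=
  ∀ n : ℕ, n + 2 ≤ p.length →
    ((G.Adj (p.getVert n) (p.getVert (n + 1)) ∧ G.Adj (p.getVert (n + 2)) (p.getVert (n + 1))) →
      ∃ d ∈ C, G.Descendant (p.getVert (n + 1)) d) ∧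
    (¬ (G.Adj (p.getVert n) (p.getVert (n + 1)) ∧
        G.Adj (p.getVert (n + 2)) (p.getVert (n + 1))) →
      p.getVert (n + 1) ∉ C)

/-- `A` and `B` are d-separated given `C` (used for pairwise disjoint `A`, `B`, `C`): no path
between a vertex of `A` and a vertex of `B` is active given `C`. For such sets this says that
`X_A` and `X_B` are conditionally independent given `X_C` in every distribution of the DAG
model of `G`. -/
def DSep (G : DAG V) (A B C : Set V) : Prop :=
  ∀ u ∈ A, ∀ v ∈ B, ∀ p : G.skeleton.Walk u v, p.IsPath → ¬ G.IsActive C p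

/-- Two DAGs are Markov equivalent if they encode the same conditional independence
relations. -/
def MarkovEquiv (G H : DAG V) : Prop :=
  ∀ A B C : Set V, Disjoint A B → Disjoint A C → Disjoint B C →
    (G.DSep A B C ↔ H.DSep A B C)

/-- Markov equivalence as an equivalence relation. -/
def markovSetoid (V : Type*) : Setoid (DAG V) where
  r := MarkovEquiv
  iseqv :=
    { refl := fun _ _ _ _ _ _ _ => Iff.rfl
      symm := fun h A B C h₁ h₂ h₃ => (h A B C h₁ h₂ h₃).symm
      trans := fun h h' A B C h₁ h₂ h₃ => (h A B C h₁ h₂ h₃).trans (h' A B C h₁ h₂ h₃) }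

end DAG

/-- The Markov equivalence classes of DAGs on `V`. -/
def MEC (V : Type*) : Type _ := Quotient (DAG.markovSetoid V)

/-- `M(T)`: the number of Markov equivalence classes of DAGs with skeleton `T`. -/
noncomputable def numMEC {V : Type*} (T : SimpleGraph V) : ℕ :=
  {c : MEC V | ∃ G : DAG V, G.skeleton = T ∧ Quotient.mk (DAG.markovSetoid V) G = c}.ncard

/-- The nodes of the complete binary tree with `k` levels: a node is the sequence of left/right
choices on the way from the root `[]` to it. There are `2 ^ k - 1` of them. -/
abbrev TreeNode (k : ℕ) : Type := {w : List Bool // w.length < k}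

/-- The complete binary tree `T_k`: every node `u` is joined to its children `u ++ [b]`. -/
def completeBinaryTree (k : ℕ) : SimpleGraph (TreeNode k) :=
  SimpleGraph.fromRel fun u v => ∃ b : Bool, v.1 = u.1 ++ [b]

/-- The additive tree `A_k`: the tree `T_k` with one new leaf `none` joined to its root. -/
def additiveTree (k : ℕ) : SimpleGraph (Option (TreeNode k)) :=
  SimpleGraph.fromRel fun u v =>
    match u, v with
    | some a, some b => (completeBinaryTree k).Adj a b
    | none, some a => a.1 = []
    | _, none => False

/-! On an acyclic skeleton, Markov equivalence amounts to having the same colliders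
(`markovEquiv_iff_colliders_eq`), so M counts the collider sets of orientations
(`numMEC_eq_ncard_colliders`). Lower bound: making the new leaf a sink embeds the collider sets of
`T_k` into those of `A_k`. Orienting every edge of `T_k` towards the root and the new leaf into the
root yields a collider set outside the image. Upper bound: a collider set of `A_k` is determined by
its restriction to `T_k` and two bits, telling which children of the root collide with the new leaf.
This gives the factor 4. It is not attained: once one bit is true, the other is dictated by whether
the two children collide. -/

namespace SimpleGraph

/-! ### Acyclicity of the two trees. -/

/-- The infinite binary tree on finite words. -/
def wordTree : SimpleGraph (List Bool) :=
  SimpleGraph.fromRel fun u v => ∃ b : Bool, v = u ++ [b]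

/-- Every edge is a bridge: the edge from `u` to `u ++ [b]` is the only one leaving the set of words
with prefix `u ++ [b]`. -/
theorem wordTree_isAcyclic : wordTree.IsAcyclic := by
  have key : ∀ (u : List Bool) (b : Bool),
      ¬ (wordTree \ fromEdgeSet {s(u, u ++ [b])}).Reachable u (u ++ [b]) := by
    intro u b hr
    have step : ∀ x y, (wordTree \ fromEdgeSet {s(u, u ++ [b])}).Adj x y →
        (u ++ [b] <+: y) → (u ++ [b] <+: x) := by
      intro x y hxy hy
      rw [sdiff_adj, wordTree, fromRel_adj] at hxy
      obtain ⟨⟨hne, h⟩, hs⟩ := hxy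
      rcases h with ⟨c, rfl⟩ | ⟨c, rfl⟩
      · rcases List.prefix_concat_iff.1 hy with h | h
        · exfalso
          apply hs
          obtain ⟨h1, h2⟩ := List.append_inj' h rfl
          simp_all
        · exact h
      · exact hy.trans (List.prefix_append _ _)
    obtain ⟨p⟩ := hr
    have walk : ∀ {x y} (_ : (wordTree \ fromEdgeSet {s(u, u ++ [b])}).Walk x y),
        (u ++ [b] <+: y) → (u ++ [b] <+: x) := by
      intro x y q
      induction q with
      | nil => exact id
      | cons h _ ih => exact fun hy => step _ _ h (ih hy)
    have := (walk p List.prefix_rfl).length_le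
    simp at this
  rw [isAcyclic_iff_forall_adj_isBridge]
  intro v w hvw
  rw [isBridge_iff]
  have h := hvw
  rw [wordTree, fromRel_adj] at h
  rcases h.2 with ⟨b, rfl⟩ | ⟨b, rfl⟩
  · exact key _ _
  · rw [reachable_comm, Sym2.eq_swap]
    exact key _ _

end SimpleGraph

theorem completeBinaryTree_adj {k : ℕ} {u v : TreeNode k} :
    (completeBinaryTree k).Adj u v ↔ (∃ b, v.1 = u.1 ++ [b]) ∨ ∃ b, u.1 = v.1 ++ [b] := by
  rw [completeBinaryTree, SimpleGraph.fromRel_adj]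
  refine and_iff_right_of_imp ?_
  rintro (⟨b, h⟩ | ⟨b, h⟩) rfl <;> simpa using congrArg List.length h

theorem additiveTree_adj_some {k : ℕ} {u v : TreeNode k} :
    (additiveTree k).Adj (some u) (some v) ↔ (completeBinaryTree k).Adj u v := by
  rw [additiveTree, SimpleGraph.fromRel_adj]
  simp only [ne_eq, Option.some.injEq]
  constructor
  · rintro ⟨-, h | h⟩
    exacts [h, h.symm]
  · exact fun h => ⟨h.ne, Or.inl h⟩

theorem additiveTree_adj_none {k : ℕ} {v : TreeNode k} :
    (additiveTree k).Adj none (some v) ↔ v.1 = [] := by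
  simp [additiveTree, SimpleGraph.fromRel_adj]

theorem completeBinaryTree_isAcyclic (k : ℕ) : (completeBinaryTree k).IsAcyclic := by
  refine SimpleGraph.wordTree_isAcyclic.comap
    (⟨fun u => u.1, ?_⟩ : completeBinaryTree k →g SimpleGraph.wordTree) Subtype.val_injective
  intro u v h
  rw [SimpleGraph.wordTree, SimpleGraph.fromRel_adj]
  exact ⟨fun e => h.ne (Subtype.ext e), completeBinaryTree_adj.1 h⟩

theorem additiveTree_isAcyclic (k : ℕ) : (additiveTree k).IsAcyclic := by
  -- The new leaf becomes the empty word, and `T_k` hangs below it on the branch `true`.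
  let f : Option (TreeNode k) → List Bool := fun u => u.elim [] fun w => true :: w.1
  have hf : Function.Injective f := by
    rintro (_ | u) (_ | v) h
    · rfl
    · simp [f] at h
    · simp [f] at h
    · simpa [f, Subtype.ext_iff] using h
  refine SimpleGraph.wordTree_isAcyclic.comap
    (⟨f, ?_⟩ : additiveTree k →g SimpleGraph.wordTree) hf
  have root : ∀ v : TreeNode k, v.1 = [] → ∃ b, f (some v) = f none ++ [b] :=
    fun v hv => ⟨true, by simp [f, hv]⟩
  intro u v h
  rw [SimpleGraph.wordTree, SimpleGraph.fromRel_adj]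
  refine ⟨fun e => h.ne (hf e), ?_⟩
  match u, v, h with
  | none, none, h => exact absurd rfl h.ne
  | none, some v, h => exact Or.inl (root v (additiveTree_adj_none.1 h))
  | some u, none, h => exact Or.inr (root u (additiveTree_adj_none.1 h.symm))
  | some u, some v, h =>
    simpa [f] using completeBinaryTree_adj.1 (additiveTree_adj_some.1 h)

instance (k : ℕ) : Finite (TreeNode k) := (List.finite_length_lt Bool k).to_subtype

/-! ### Markov equivalence and colliders. -/

namespace DAG

variable {V W : Type*}

@[ext]
theorem ext_adj {G H : DAG V} (h : ∀ u v, G.Adj u v ↔ H.Adj u v) : G = H := by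
  obtain ⟨G, hG⟩ := G
  obtain ⟨H, hH⟩ := H
  congr
  ext u v
  exact h u v

instance [Finite V] : Finite (DAG V) :=
  Finite.of_injective (fun G : DAG V => G.Adj) fun _ _ h =>
    ext_adj fun u v => iff_of_eq (congrFun (congrFun h u) v)

theorem asymm (G : DAG V) {u v : V} (h : G.Adj u v) : ¬ G.Adj v u := fun h' =>
  G.acyclic u (.tail (.single h) h')

/-- The colliders `a → b ← c` of a DAG. -/
def colliders (G : DAG V) : Set (V × V × V) :=
  {t | G.Adj t.1 t.2.1 ∧ G.Adj t.2.2 t.2.1 ∧ t.1 ≠ t.2.2}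

theorem mem_colliders {G : DAG V} {a b c : V} :
    (a, b, c) ∈ G.colliders ↔ G.Adj a b ∧ G.Adj c b ∧ a ≠ c := Iff.rfl

/-- A common arrow into `x` propagates along a directed path: were `x → y` reversed in `H`, then `a
→ x ← y` would be a collider of `H` only. -/
theorem Descendant.of_colliders_eq {G H : DAG V} (hs : G.skeleton = H.skeleton)
    (hc : G.colliders = H.colliders) {b d : V} (h : G.Descendant b d) {a : V}
    (hG : G.Adj a b) (hH : H.Adj a b) : H.Descendant b d := by
  induction h using Relation.ReflTransGen.head_induction_on generalizing a with
  | refl => exact .refl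
  | @head x y hxy _ ih =>
    have hH' : H.Adj x y := by
      have hadj : H.skeleton.Adj x y := hs ▸ (Or.inl hxy : G.skeleton.Adj x y)
      refine hadj.resolve_right fun hyx => ?_
      have hay : a ≠ y := fun e => G.asymm hxy (e ▸ hG)
      have : (a, x, y) ∈ G.colliders := hc ▸ mem_colliders.2 ⟨hH, hyx, hay⟩
      exact G.asymm hxy this.2.1
    exact .head hH' (ih hxy hH')

/-- Activity given `C` of a path in an undirected graph containing the skeleton. -/
def IsActiveIn (G : DAG V) {S : SimpleGraph V} (C : Set V) {u v : V} (p : S.Walk u v) : Prop :=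
  ∀ n : ℕ, n + 2 ≤ p.length →
    ((G.Adj (p.getVert n) (p.getVert (n + 1)) ∧ G.Adj (p.getVert (n + 2)) (p.getVert (n + 1))) →
      ∃ d ∈ C, G.Descendant (p.getVert (n + 1)) d) ∧
    (¬ (G.Adj (p.getVert n) (p.getVert (n + 1)) ∧
        G.Adj (p.getVert (n + 2)) (p.getVert (n + 1))) →
      p.getVert (n + 1) ∉ C)

theorem dSep_iff {G : DAG V} {S : SimpleGraph V} (hG : G.skeleton = S) {A B C : Set V} :
    G.DSep A B C ↔ ∀ u ∈ A, ∀ v ∈ B, ∀ p : S.Walk u v, p.IsPath → ¬ G.IsActiveIn C p := by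
  subst hG
  rfl

theorem IsActiveIn.of_colliders_eq {G H : DAG V} {S : SimpleGraph V} (hG : G.skeleton = S)
    (hH : H.skeleton = S) (hc : G.colliders = H.colliders) {C : Set V} {u v : V}
    {p : S.Walk u v} (hp : p.IsPath) (h : G.IsActiveIn C p) : H.IsActiveIn C p := by
  intro n hn
  have hne : p.getVert n ≠ p.getVert (n + 2) := fun e => by
    have := hp.getVert_injOn (by simp; omega) (by simp; omega) e
    omega
  have iff : (G.Adj (p.getVert n) (p.getVert (n + 1)) ∧
      G.Adj (p.getVert (n + 2)) (p.getVert (n + 1))) ↔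
      (H.Adj (p.getVert n) (p.getVert (n + 1)) ∧
      H.Adj (p.getVert (n + 2)) (p.getVert (n + 1))) := by
    have := Set.ext_iff.1 hc (p.getVert n, p.getVert (n + 1), p.getVert (n + 2))
    simpa only [mem_colliders, and_iff_left hne] using this
  rw [← iff]
  refine ⟨fun hcol => ?_, (h n hn).2⟩
  obtain ⟨d, hd, hdesc⟩ := (h n hn).1 hcol
  exact ⟨d, hd, hdesc.of_colliders_eq (hG.trans hH.symm) hc hcol.1 (iff.1 hcol).1⟩

theorem markovEquiv_of_colliders_eq {G H : DAG V} (hs : G.skeleton = H.skeleton)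
    (hc : G.colliders = H.colliders) : G.MarkovEquiv H := by
  intro A B C _ _ _
  rw [dSep_iff hs, dSep_iff (rfl : H.skeleton = H.skeleton)]
  exact forall₄_congr fun u _ v _ => forall₂_congr fun p hp => not_congr
    ⟨.of_colliders_eq hs rfl hc hp, .of_colliders_eq rfl hs hc.symm hp⟩

/-- In a forest `a, b, c` is the only path from `a` to `c`. Given `∅`, it is blocked exactly when
`b` is a collider on it. -/
theorem colliders_subset_of_markovEquiv {G H : DAG V} {S : SimpleGraph V} (hS : S.IsAcyclic)
    (hG : G.skeleton = S) (hH : H.skeleton = S) (h : G.MarkovEquiv H) :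
    G.colliders ⊆ H.colliders := by
  rintro ⟨a, b, c⟩ hcol
  obtain ⟨hab, hcb, hac⟩ := mem_colliders.1 hcol
  have hab' : S.Adj a b := hG ▸ (Or.inl hab : G.skeleton.Adj a b)
  have hbc' : S.Adj b c := hG ▸ (Or.inr hcb : G.skeleton.Adj b c)
  let q : S.Walk a c := .cons hab' (.cons hbc' .nil)
  have hq : q.IsPath := by
    simp [q, SimpleGraph.Walk.cons_isPath_iff, hab'.ne, hbc'.ne, hac]
  have hsep : G.DSep {a} {c} ∅ := by
    rw [dSep_iff hG]
    rintro _ rfl _ rfl p hp hact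
    have hpq : p = q :=
      congrArg Subtype.val ((hS.subsingleton_path _ _).elim ⟨p, hp⟩ ⟨q, hq⟩)
    subst hpq
    obtain ⟨d, hd, -⟩ := (hact 0 (by simp [q])).1 ⟨hab, hcb⟩
    exact hd
  rw [h _ _ _ (by simpa using hac) (by simp) (by simp), dSep_iff hH] at hsep
  by_contra hn
  refine hsep a rfl c rfl q hq fun n hn' => ⟨fun hcol' => ?_, fun _ => by simp⟩
  obtain rfl : n = 0 := by simp [q] at hn'; exact hn'
  exact absurd (mem_colliders.2 ⟨hcol'.1, hcol'.2, hac⟩) hn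

/-- The DAGs with skeleton `S`. -/
def withSkeleton (S : SimpleGraph V) : Set (DAG V) := {G | G.skeleton = S}

theorem markovEquiv_iff_colliders_eq {G H : DAG V} {S : SimpleGraph V} (hS : S.IsAcyclic)
    (hG : G ∈ withSkeleton S) (hH : H ∈ withSkeleton S) :
    G.MarkovEquiv H ↔ G.colliders = H.colliders :=
  ⟨fun h => (colliders_subset_of_markovEquiv hS hG hH h).antisymm
    (colliders_subset_of_markovEquiv hS hH hG ((markovSetoid V).symm h)),
    markovEquiv_of_colliders_eq (hG.trans hH.symm)⟩

/-- Orientation of an undirected graph along a natural-valued rank. -/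
def ofRank (S : SimpleGraph V) (f : V → ℕ) : DAG V where
  Adj u v := S.Adj u v ∧ f u < f v
  acyclic v h := by
    have : ∀ x y, Relation.TransGen (fun u v => S.Adj u v ∧ f u < f v) x y → f x < f y := by
      intro x y h
      induction h with
      | single h => exact h.2
      | tail _ h ih => exact ih.trans h.2
    exact (this v v h).ne rfl

theorem ofRank_mem_withSkeleton {S : SimpleGraph V} {f : V → ℕ}
    (hf : ∀ u v, S.Adj u v → f u ≠ f v) : ofRank S f ∈ withSkeleton S := by
  ext u v
  constructor
  · rintro (h | h)
    exacts [h.1, h.1.symm]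
  · intro h
    rcases (hf u v h).lt_or_gt with h' | h'
    exacts [Or.inl ⟨h, h'⟩, Or.inr ⟨h.symm, h'⟩]

/-- Pullback of a DAG along a map of vertices. -/
def comap (f : W → V) (G : DAG V) : DAG W where
  Adj u v := G.Adj (f u) (f v)
  acyclic v h := G.acyclic (f v) (Relation.TransGen.lift f (fun _ _ h => h) _ _ h)

/-- Addition of a new sink `none`, with arrows from all vertices satisfying `r`. -/
def addSink (G : DAG V) (r : V → Prop) : DAG (Option V) where
  Adj
    | some a, some b => G.Adj a b
    | some a, none => r a
    | none, _ => False
  acyclic v h := by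
    have key : ∀ {x y : Option V}, Relation.TransGen (fun x y : Option V => match x, y with
        | some a, some b => G.Adj a b
        | some a, none => r a
        | none, _ => False) x y →
        ∃ a, x = some a ∧ ∀ b, y = some b → Relation.TransGen G.Adj a b := by
      intro x y h
      induction h using Relation.TransGen.head_induction_on with
      | @single x h =>
        match x, y, h with
        | some a, some c, h => exact ⟨a, rfl, by rintro _ ⟨⟩; exact .single h⟩
        | some a, none, h => exact ⟨a, rfl, by rintro _ ⟨⟩⟩
      | @head x z h _ ih =>
        obtain ⟨c, rfl, hc⟩ := ih
        match x, h with
        | some a, h => exact ⟨a, rfl, fun b hb => .head h (hc b hb)⟩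
    obtain ⟨a, rfl, ha⟩ := key h
    exact G.acyclic a (ha a rfl)

end DAG

/-! ### Counting collider sets. -/

theorem Set.ncard_image_eq_of_eq_iff {α β γ : Type*} {s : Set α} {f : α → β} {g : α → γ}
    (h : ∀ x ∈ s, ∀ y ∈ s, f x = f y ↔ g x = g y) : (f '' s).ncard = (g '' s).ncard := by
  refine Set.ncard_congr (fun b hb => g hb.choose) (fun b hb => ⟨_, hb.choose_spec.1, rfl⟩) ?_ ?_
  · intro b c hb hc e
    rw [← hb.choose_spec.2, ← hc.choose_spec.2]
    exact (h _ hb.choose_spec.1 _ hc.choose_spec.1).2 e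
  · rintro _ ⟨x, hx, rfl⟩
    have hb : f x ∈ f '' s := ⟨x, hx, rfl⟩
    exact ⟨f x, hb, (h _ hb.choose_spec.1 _ hx).1 hb.choose_spec.2⟩

open DAG

theorem numMEC_eq_ncard_colliders {V : Type*} {S : SimpleGraph V} (hS : S.IsAcyclic) :
    numMEC S = (colliders '' withSkeleton S).ncard := by
  have : numMEC S = (Quotient.mk (markovSetoid V) '' withSkeleton S).ncard := rfl
  rw [this]
  exact Set.ncard_image_eq_of_eq_iff fun G hG H hH =>
    Quotient.eq.trans (markovEquiv_iff_colliders_eq hS hG hH)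

theorem exists_mem_withSkeleton_completeBinaryTree (k : ℕ) :
    (withSkeleton (completeBinaryTree k)).Nonempty := by
  refine ⟨_, ofRank_mem_withSkeleton (f := fun u => u.1.length) fun u v h => ?_⟩
  rcases completeBinaryTree_adj.1 h with ⟨b, h⟩ | ⟨b, h⟩ <;> simp [h]

theorem comap_some_mem_withSkeleton {k : ℕ} {G : DAG (Option (TreeNode k))}
    (hG : G ∈ withSkeleton (additiveTree k)) :
    G.comap some ∈ withSkeleton (completeBinaryTree k) := by
  ext u v
  rw [← additiveTree_adj_some, ← (hG : G.skeleton = _)]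
  rfl

theorem addSink_mem_withSkeleton {k : ℕ} {G : DAG (TreeNode k)}
    (hG : G ∈ withSkeleton (completeBinaryTree k)) :
    G.addSink (fun u => u.1 = []) ∈ withSkeleton (additiveTree k) := by
  ext u v
  match u, v with
  | none, none => exact iff_of_false (fun h => h.elim id id) fun h => h.ne rfl
  | none, some v =>
    rw [additiveTree_adj_none]
    exact iff_of_eq (false_or _)
  | some u, none =>
    rw [SimpleGraph.adj_comm, SimpleGraph.adj_comm (additiveTree k), additiveTree_adj_none]
    exact iff_of_eq (false_or _)
  | some u, some v =>
    rw [additiveTree_adj_some, ← (hG : G.skeleton = _)]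
    rfl

theorem colliders_addSink {V : Type*} (G : DAG V) {r : V → Prop} (hr : ∀ a b, r a → r b → a = b) :
    (G.addSink r).colliders = Prod.map some (Prod.map some some) '' G.colliders := by
  ext ⟨a, b, c⟩
  constructor
  · intro h
    obtain ⟨hab, hcb, hac⟩ := mem_colliders.1 h
    match a, b, c, hab, hcb, hac with
    | some a, some b, some c, hab, hcb, hac =>
      exact ⟨(a, b, c), ⟨hab, hcb, fun e => hac (congrArg some e)⟩, rfl⟩
    | some a, none, some c, hab, hcb, hac =>
      exact absurd (congrArg some (hr a c hab hcb)) hac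
  · rintro ⟨⟨a', b', c'⟩, ⟨h1, h2, h3⟩, e⟩
    cases e
    exact ⟨h1, h2, fun e => h3 (Option.some.inj e)⟩

theorem numMEC_completeBinaryTree_lt_additiveTree {k : ℕ} (hk : 2 ≤ k) :
    numMEC (completeBinaryTree k) < numMEC (additiveTree k) := by
  rw [numMEC_eq_ncard_colliders (completeBinaryTree_isAcyclic k),
    numMEC_eq_ncard_colliders (additiveTree_isAcyclic k)]
  have hinj : Function.Injective
      (Prod.map some (Prod.map some some) : TreeNode k × TreeNode k × TreeNode k → _) :=
    (Option.some_injective _).prodMap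
      ((Option.some_injective _).prodMap (Option.some_injective _))
  rw [← Set.ncard_image_of_injective _ hinj.image_injective]
  refine Set.ncard_lt_ncard ⟨?_, fun hsub => ?_⟩ (Set.toFinite _)
  · rintro _ ⟨_, ⟨G, hG, rfl⟩, rfl⟩
    exact ⟨_, addSink_mem_withSkeleton hG, colliders_addSink G fun a b ha hb =>
      Subtype.ext (ha.trans hb.symm)⟩
  -- The rank decreases with depth and is positive on `T_k`, so the new leaf, of rank 0, points into
  -- the root, as do the root's children.
  · let f : Option (TreeNode k) → ℕ := fun u => u.elim 0 fun w => k - w.1.length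
    have hmem : ofRank (additiveTree k) f ∈ withSkeleton (additiveTree k) := by
      refine ofRank_mem_withSkeleton fun u v h => ?_
      match u, v, h with
      | none, none, h => exact absurd rfl h.ne
      | none, some v, _ => have := v.2; simp only [f, Option.elim]; omega
      | some u, none, _ => have := u.2; simp only [f, Option.elim]; omega
      | some u, some v, h =>
        have := u.2
        have := v.2
        rcases completeBinaryTree_adj.1 (additiveTree_adj_some.1 h) with ⟨b, h⟩ | ⟨b, h⟩ <;>
        · have := congrArg List.length h
          simp only [List.length_append, List.length_singleton] at this
          simp only [f, Option.elim]
          omega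
    obtain ⟨P, -, hP⟩ := hsub ⟨_, hmem, rfl⟩
    let r : TreeNode k := ⟨[], by simp; omega⟩
    let c : TreeNode k := ⟨[true], by simp; omega⟩
    have hcol : (none, some r, some c) ∈ (ofRank (additiveTree k) f).colliders := by
      refine mem_colliders.2 ⟨⟨additiveTree_adj_none.2 rfl, ?_⟩,
        ⟨additiveTree_adj_some.2 (completeBinaryTree_adj.2 (Or.inr ⟨true, rfl⟩)), ?_⟩, by simp⟩
      · simp [f, r]; omega
      · simp [f, r, c]; omega
    rw [← hP] at hcol
    obtain ⟨_, _, e⟩ := hcol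
    cases e

theorem numMEC_additiveTree_lt {k : ℕ} (hk : 2 ≤ k) :
    numMEC (additiveTree k) < numMEC (completeBinaryTree k) * 4 := by
  rw [numMEC_eq_ncard_colliders (completeBinaryTree_isAcyclic k),
    numMEC_eq_ncard_colliders (additiveTree_isAcyclic k)]
  let r : TreeNode k := ⟨[], by simp; omega⟩
  let c : Bool → TreeNode k := fun b => ⟨[b], by simp; omega⟩
  have hcr : ∀ b, c b ≠ r := by simp [c, r]
  let Φ : Set (Option (TreeNode k) × Option (TreeNode k) × Option (TreeNode k)) →
      Set (TreeNode k × TreeNode k × TreeNode k) × Prop × Prop := fun P =>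
    (Prod.map some (Prod.map some some) ⁻¹' P,
      (none, some r, some (c true)) ∈ P, (none, some r, some (c false)) ∈ P)
  have hrestrict : ∀ G : DAG (Option (TreeNode k)),
      Prod.map some (Prod.map some some) ⁻¹' G.colliders = (G.comap some).colliders := by
    intro G
    ext ⟨a, b, d⟩
    exact and_congr Iff.rfl (and_congr Iff.rfl (not_congr (Option.some.injEq _ _).to_iff))
  have hsymm : ∀ {G : DAG (Option (TreeNode k))} {a b d},
      (a, b, d) ∈ G.colliders → (d, b, a) ∈ G.colliders := fun h => ⟨h.2.1, h.1, h.2.2.symm⟩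
  have hsub : ∀ G ∈ withSkeleton (additiveTree k), ∀ H ∈ withSkeleton (additiveTree k),
      Φ G.colliders = Φ H.colliders → G.colliders ⊆ H.colliders := by
    intro G hG H hH e
    have hadj : ∀ {x y}, G.Adj x y → (additiveTree k).Adj x y := fun {x y} h =>
      (hG : G.skeleton = _) ▸ (Or.inl h : G.skeleton.Adj x y)
    have e1 := congrArg Prod.fst e
    have e2 := congrArg (fun x => x.2.1) e
    have e3 := congrArg (fun x => x.2.2) e
    -- A collider ending at the new leaf is centred at the root, its only neighbour, so its other
    -- end is a child of the root.
    have hleaf : ∀ b d, (none, b, some d) ∈ G.colliders → (none, b, some d) ∈ H.colliders := by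
      intro b d h
      match b, hadj h.1, hadj h.2.1 with
      | some b, hb, hd =>
        obtain rfl : b = r := Subtype.ext (additiveTree_adj_none.1 hb)
        rcases completeBinaryTree_adj.1 (additiveTree_adj_some.1 hd) with ⟨x, hx⟩ | ⟨x, hx⟩
        · simp [r] at hx
        · obtain rfl : d = c x := Subtype.ext hx
          cases x
          · exact e3.mp h
          · exact e2.mp h
    rintro ⟨a, b, d⟩ h
    match a, b, d, h with
    | none, b, none, h => exact absurd rfl h.2.2
    | none, b, some d, h => exact hleaf b d h
    | some a, b, none, h => exact hsymm (hleaf b a (hsymm h))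
    | some a, none, some d, h =>
      refine absurd ?_ h.2.2
      exact congrArg some (Subtype.ext ((additiveTree_adj_none.1 (hadj h.1).symm).trans
        (additiveTree_adj_none.1 (hadj h.2.1).symm).symm))
    | some a, some b, some d, h =>
      exact (Set.ext_iff.1 e1 (a, b, d)).1 h
  have hinj : Set.InjOn Φ (colliders '' withSkeleton (additiveTree k)) := by
    rintro _ ⟨G, hG, rfl⟩ _ ⟨H, hH, rfl⟩ e
    exact (hsub G hG H hH e).antisymm (hsub H hH G hG e.symm)
  have hcard : (Set.univ : Set (Prop × Prop)).ncard = 4 := by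
    rw [Set.ncard_univ, Nat.card_prod]
    simp
  rw [← hinj.ncard_image, ← hcard, ← Set.ncard_prod]
  refine Set.ncard_lt_ncard ⟨?_, fun hsup => ?_⟩ (Set.toFinite _)
  · rintro _ ⟨_, ⟨G, hG, rfl⟩, rfl⟩
    exact ⟨⟨_, comap_some_mem_withSkeleton hG, (hrestrict G).symm⟩, trivial⟩
  · obtain ⟨G, hG⟩ := exists_mem_withSkeleton_completeBinaryTree k
    have hne : (some (c true) : Option (TreeNode k)) ≠ some (c false) := by simp [c]
    -- If one leaf collider occurs, the other one occurs exactly when the two children collide.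
    obtain ⟨_, ⟨H, hH, rfl⟩, e⟩ :=
      @hsup (G.colliders, True, (c true, r, c false) ∉ G.colliders) ⟨⟨G, hG, rfl⟩, trivial⟩
    have e1 : _ = G.colliders := congrArg Prod.fst e
    have e2 : ((none, some r, some (c true)) ∈ H.colliders) = True := congrArg (fun x => x.2.1) e
    have e3 : ((none, some r, some (c false)) ∈ H.colliders) =
        ((c true, r, c false) ∉ G.colliders) := congrArg (fun x => x.2.2) e
    have h2 : (none, some r, some (c true)) ∈ H.colliders := of_eq_true e2
    have h1 : (some (c true), some r, some (c false)) ∈ H.colliders ↔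
      (c true, r, c false) ∈ G.colliders := Set.ext_iff.1 e1 (c true, r, c false)
    by_cases h : (c true, r, c false) ∈ G.colliders
    · exact e3.mp (mem_colliders.2 ⟨h2.1, (h1.2 h).2.1, by simp⟩) h
    · exact h (h1.1 ⟨h2.2.1, (e3.mpr h).2.1, hne⟩)

theorem mainTheorem10 (k : ℕ) (hk : 2 ≤ k) :
    1 < (numMEC (additiveTree k) : ℝ) / (numMEC (completeBinaryTree k) : ℝ) ∧
      (numMEC (additiveTree k) : ℝ) / (numMEC (completeBinaryTree k) : ℝ) < 4 := by
  have h4 := numMEC_additiveTree_lt hk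
  have hpos : (0 : ℝ) < numMEC (completeBinaryTree k) := by
    -- The strict upper bound already rules out a zero denominator.
    exact_mod_cast (show 0 < numMEC (completeBinaryTree k) by omega)
  rw [one_lt_div hpos, div_lt_iff₀ hpos, mul_comm]
  exact ⟨by exact_mod_cast numMEC_completeBinaryTree_lt_additiveTree hk, by exact_mod_cast h4⟩
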